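/- All digraphs are finite. A semicomplete $r$-partite digraph ($r\ge 2$) is a digraph whose vertex set is partitioned into $r$ nonempty partite sets such that two vertices in different partite sets are joined by an arc in at least one direction (possibly both) and there is no arc between vertices of the same partite set. The digraph is $m$-colored if each arc is assigned one of $m$ colors; a subdigraph is at most $k$-colored if its arcs use at most $k$ colors, and monochromatic if all its arcs have the same color. A $k$-colored kernel of an $m$-colored digraph $D$ is a nonempty set $K$ of vertices such that for every vertex $u\notin K$ there is a directed path, using at least one and at most $k$ colors, from $u$ to some vertex of $K$, and for all $u,v\in K$ there is no directed path from $u$ to $v$ using at least one and at most $k$ colors. Here $\overrightarrow{C}_n$ is the directed cycle of length $n$; $\overrightarrow{C}_3\uparrow\overrightarrow{C}_3$ is the digraph on four vertices formed by two directed triangles sharing exactly one arc; $\overrightarrow{C}_4\upuparrows\overrightarrow{C}_4$ is the digraph on five vertices formed by two directed $4$-cycles sharing exactly two consecutive arcs. "Contained" means contained as a not necessarily induced subdigraph. Let $D$ be an $m$-colored semicomplete $r$-partite digraph, $r\ge 2$. (i) If $r\ge 3$ and every $\overrightarrow{C}_3$ and every $\overrightarrow{C}_4$ contained in $D$ is monochromatic,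 then $D$ has a $2$-colored kernel. (ii) If $r\ge 3$, every $\overrightarrow{C}_4$ contained in $D$ is at most $2$-colored and, either every $\overrightarrow{C}_5$ contained in $D$ is at most $3$-colored or every $\overrightarrow{C}_3\uparrow\overrightarrow{C}_3$ contained in $D$ is at most $2$-colored, then $D$ has a $3$-colored kernel. (iii) For every $k\ge 4$, $D$ has a $k$-colored kernel. (iv) Let $r=2$. If every $\overrightarrow{C}_4\upuparrows\overrightarrow{C}_4$ contained in $D$ is at most $2$-colored and no $\overrightarrow{C}_4$ contained in $D$ has four arcs of pairwise different colors, then $D$ has a $2$-colored kernel. If every $\overrightarrow{C}_4\upuparrows\overrightarrow{C}_4$ contained in $D$ is at most $3$-colored, then $D$ has a $3$-colored kernel. -/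

import Mathlib

namespace ColoredDigraph

/-- A semicomplete `r`-partite digraph: the vertex set is split into `r` nonempty partite sets,
and two vertices are joined by at least one arc (possibly by both opposite arcs) exactly when
they lie in different partite sets. In particular there are no loops. -/
def IsSemicompletePartite {V : Type*} (D : Digraph V) (r : ℕ) : Prop :=
  ∃ part : V → Fin r, Function.Surjective part ∧
    ∀ u v : V, (D.Adj u v ∨ D.Adj v u) ↔ part u ≠ part v

/-- The directed path with `n` arcs `0 → 1 → ⋯ → n`. -/
def dirPath (n : ℕ) : Digraph (Fin (n + 1)) where
  Adj a b := (a : ℕ) + 1 = (b : ℕ)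

/-- The directed cycle of length `n`, that is `0 → 1 → ⋯ → n - 1 → 0`. -/
def dirCycle (n : ℕ) [NeZero n] : Digraph (Fin n) where
  Adj a b := a + 1 = b

/-- Two directed triangles `0 → 1 → 2 → 0` and `0 → 1 → 3 → 0` that share the arc `0 → 1`. -/
def twoTriangles : Digraph (Fin 4) where
  Adj a b := (a, b) ∈ ({(0, 1), (1, 2), (2, 0), (1, 3), (3, 0)} : Set (Fin 4 × Fin 4))

/-- Two directed 4-cycles `0 → 1 → 2 → 3 → 0` and `0 → 1 → 2 → 4 → 0` that share the two
consecutive arcs `0 → 1 → 2`. -/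
def twoFourCycles : Digraph (Fin 5) where
  Adj a b := (a, b) ∈ ({(0, 1), (1, 2), (2, 3), (3, 0), (2, 4), (4, 0)} : Set (Fin 5 × Fin 5))

/-- `φ` exhibits a copy of `H` as a (not necessarily induced) subdigraph of `D`. -/
def IsCopy {W V : Type*} (H : Digraph W) (D : Digraph V) (φ : W → V) : Prop :=
  Function.Injective φ ∧ ∀ a b : W, H.Adj a b → D.Adj (φ a) (φ b)

/-- The set of colors used on the arcs of the copy `φ` of `H`, where the arc `(u, v)` has the
color `c u v` (values of `c` at pairs that are not arcs never matter). -/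
def colorsOn {W V : Type*} {m : ℕ} (H : Digraph W) (c : V → V → Fin m) (φ : W → V) :
    Set (Fin m) :=
  {i | ∃ a b : W, H.Adj a b ∧ c (φ a) (φ b) = i}

/-- Every copy of `H` contained in `D` is at most `k`-colored. -/
def EveryCopyAtMost {W V : Type*} {m : ℕ} (D : Digraph V) (c : V → V → Fin m)
    (H : Digraph W) (k : ℕ) : Prop :=
  ∀ φ : W → V, IsCopy H D φ → (colorsOn H c φ).ncard ≤ k

/-- Every copy of `H` contained in `D` is monochromatic. -/
def EveryCopyMonochromatic {W V : Type*} {m : ℕ} (D : Digraph V) (c : V → V → Fin m)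
    (H : Digraph W) : Prop :=
  ∀ φ : W → V, IsCopy H D φ → ∃ i : Fin m, ∀ a b : W, H.Adj a b → c (φ a) (φ b) = i

/-- There is a directed path from `u` to `v` whose arcs use exactly `j` colors. -/
def HasColoredPath {V : Type*} {m : ℕ} (D : Digraph V) (c : V → V → Fin m) (j : ℕ)
    (u v : V) : Prop :=
  ∃ (n : ℕ) (φ : Fin (n + 1) → V), IsCopy (dirPath n) D φ ∧ φ 0 = u ∧ φ (Fin.last n) = v ∧
    (colorsOn (dirPath n) c φ).ncard = j

/-- `S` is a `k`-colored absorbent set. -/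
def IsAbsorbent {V : Type*} {m : ℕ} (D : Digraph V) (c : V → V → Fin m) (k : ℕ)
    (S : Set V) : Prop :=
  S.Nonempty ∧ ∀ u, u ∉ S → ∃ v ∈ S, ∃ j, 1 ≤ j ∧ j ≤ k ∧ HasColoredPath D c j u v

/-- `S` is a `k`-colored independent set. -/
def IsIndependent {V : Type*} {m : ℕ} (D : Digraph V) (c : V → V → Fin m) (k : ℕ)
    (S : Set V) : Prop :=
  S.Nonempty ∧ ∀ u ∈ S, ∀ v ∈ S, ¬ ∃ j, 1 ≤ j ∧ j ≤ k ∧ HasColoredPath D c j u v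

/-- `D`, with its arcs colored by `c`, has a `k`-colored kernel. -/
def HasColoredKernel {V : Type*} {m : ℕ} (D : Digraph V) (c : V → V → Fin m) (k : ℕ) : Prop :=
  ∃ K : Set V, IsAbsorbent D c k K ∧ IsIndependent D c k K

end ColoredDigraph

namespace ColoredDigraph

open Relation

/-! Let `Q` be `Reach D c k`. A `k`-colored kernel of `D` is an ordinary kernel of `Q`, and a finite
irreflexive relation has a kernel once its asymmetric part A (pairs `Q u v` with `¬ Q v u`) has no
cycle. So everything reduces to excluding cycles of A.

For `k ≥ 2`, arcs and two-arc walks between distinct vertices are `Q`-pairs, so a pair of A has no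
arc or two-arc walk backwards. Forwards it has an arc between different parts, and a two-arc walk
within a part (`exists_two_arcs`); this is the relation `Close`. It remains to show that chains of A
are again `Close`, since the last pair closing a cycle would then be reversible. Extending a chain
can fail only at a 4-cycle a → y → b → c → a whose arc b → c lies in A. In `acyclic_of_fourCycle`
such an arc is always reversible through the other three. In the bipartite two-color case this is
known only for some arcs of the 4-cycle, and `acyclic_of_bipartite` uses a further vertex of the
chain to build two 4-cycles sharing two arcs.

The coloring thus enters only through walks of three or four arcs, whose colors are counted in the
last section. -/

/-! ### Kernels of finite relations -/

/-- A relation on a finite type whose asymmetric part has no cycle has a kernel. -/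
theorem exists_kernel_of_acyclic {V : Type*} [Finite V] (Q : V → V → Prop)
    (irrefl : ∀ v, ¬ Q v v)
    (acyclic : ∀ v, ¬ TransGen (fun u v => Q u v ∧ ¬ Q v u) v v) :
    ∃ K : Set V, (∀ u, u ∉ K → ∃ v ∈ K, Q u v) ∧ ∀ u ∈ K, ∀ v ∈ K, ¬ Q u v := by
  classical
  set A : V → V → Prop := fun u v => Q u v ∧ ¬ Q v u with hA
  have wf : WellFounded (fun x y => TransGen A y x) := by
    have : IsTrans V (fun x y => TransGen A y x) := ⟨fun _ _ _ h₁ h₂ => h₂.trans h₁⟩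
    have : Std.Irrefl (fun x y => TransGen A y x) := ⟨acyclic⟩
    exact Finite.wellFounded_of_trans_of_irrefl _
  suffices H : ∀ (n : ℕ) (S : Set V), S.ncard = n → ∃ K ⊆ S,
      (∀ u ∈ S, u ∉ K → ∃ v ∈ K, Q u v) ∧ ∀ u ∈ K, ∀ v ∈ K, ¬ Q u v by
    obtain ⟨K, -, h₁, h₂⟩ := H _ Set.univ rfl
    exact ⟨K, fun u => h₁ u trivial, h₂⟩
  intro n
  induction n using Nat.strong_induction_on with
  | _ n ih =>
    intro S hS
    rcases S.eq_empty_or_nonempty with rfl | hne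
    · exact ⟨∅, subset_rfl, by simp, by simp⟩
    -- `s` is a sink of `A` within `S`: each `Q`-arc leaving it inside `S` is reversible. Hence `s`
    -- joins any kernel of the vertices it does not absorb.
    obtain ⟨s, hs, hmin⟩ := wf.has_min S hne
    have back : ∀ u ∈ S, Q s u → Q u s := fun u hu h => by
      by_contra h'
      exact hmin u hu (.single ⟨h, h'⟩)
    obtain ⟨K, hK, h₁, h₂⟩ := ih _ (by
      rw [← hS]
      refine Set.ncard_lt_ncard (s := {u ∈ S | u ≠ s ∧ ¬ Q u s}) ?_ (Set.toFinite _)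
      exact ⟨fun u hu => hu.1, fun h => (h hs).2.1 rfl⟩) {u ∈ S | u ≠ s ∧ ¬ Q u s} rfl
    refine ⟨insert s K, Set.insert_subset hs fun u hu => (hK hu).1, ?_, ?_⟩
    · intro u hu hnot
      rw [Set.mem_insert_iff, not_or] at hnot
      by_cases h : Q u s
      · exact ⟨s, Set.mem_insert _ _, h⟩
      · obtain ⟨v, hv, huv⟩ := h₁ u ⟨hu, hnot.1, h⟩ hnot.2
        exact ⟨v, Set.mem_insert_of_mem _ hv, huv⟩
    · rintro u (rfl | hu) v (rfl | hv)
      · exact irrefl _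
      · exact fun h => (hK hv).2.2 (back v (hK hv).1 h)
      · exact (hK hu).2.2
      · exact h₂ u hu v hv

/-! ### Paths and walks -/

/-- A walk of minimal length between its ends is a path. -/
theorem exists_injOn_walk {V : Type*} {E : V → V → Prop} {u v : V} (h : ReflTransGen E u v) :
    ∃ (n : ℕ) (f : ℕ → V), f 0 = u ∧ f n = v ∧ (∀ i < n, E (f i) (f (i + 1))) ∧
      ∀ i j, i < j → j ≤ n → f i ≠ f j := by
  classical
  have ex : ∃ (n : ℕ) (f : ℕ → V), f 0 = u ∧ f n = v ∧ ∀ i < n, E (f i) (f (i + 1)) := by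
    induction h with
    | refl => exact ⟨0, fun _ => u, rfl, rfl, by simp⟩
    | @tail b c _ hbc ih =>
      obtain ⟨n, f, h0, hn, hf⟩ := ih
      refine ⟨n + 1, fun i => if i ≤ n then f i else c, by simp [h0], by simp, ?_⟩
      intro i hi
      rcases Nat.lt_succ_iff_lt_or_eq.1 hi with hi | rfl
      · simpa [hi.le, Nat.succ_le_of_lt hi] using hf i hi
      · simpa [hn] using hbc
  obtain ⟨f, h0, hn, hf⟩ := Nat.find_spec ex
  refine ⟨Nat.find ex, f, h0, hn, hf, fun i j hij hj heq => ?_⟩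
  -- A repetition `f i = f j` allows the `j - i` arcs between them to be cut out.
  refine Nat.find_min ex (m := Nat.find ex - (j - i)) (by omega)
    ⟨fun t => if t ≤ i then f t else f (t + (j - i)), by simp [h0], ?_, ?_⟩
  · dsimp only
    split_ifs with h
    · rw [show Nat.find ex - (j - i) = i by omega, heq, show j = Nat.find ex by omega]
      exact hn
    · rw [show Nat.find ex - (j - i) + (j - i) = Nat.find ex by omega]
      exact hn
  · intro t ht
    dsimp only
    rcases lt_trichotomy t i with h | rfl | h
    · rw [if_pos h.le, if_pos (Nat.succ_le_of_lt h)]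
      exact hf t (by omega)
    · rw [if_pos le_rfl, if_neg (by omega), heq, show t + 1 + (j - t) = j + 1 by omega]
      exact hf j (by omega)
    · rw [if_neg (by omega), if_neg (by omega), show t + 1 + (j - i) = t + (j - i) + 1 by omega]
      exact hf _ (by omega)

/-- `v ≠ u` can be reached from `u` by a walk that uses at most `k` colors. -/
def Reach {V : Type*} {m : ℕ} (D : Digraph V) (c : V → V → Fin m) (k : ℕ) (u v : V) : Prop :=
  u ≠ v ∧ ∃ S : Finset (Fin m), S.card ≤ k ∧
    ReflTransGen (fun x y => D.Adj x y ∧ c x y ∈ S) u v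

section Reach

variable {V : Type*} {m k : ℕ} {D : Digraph V} {c : V → V → Fin m}

/-- Shortening a walk to a path adds no color, and distinct ends force at least one arc, hence at
least one color. -/
theorem Reach.hasColoredPath {u v : V} (h : Reach D c k u v) :
    ∃ j, 1 ≤ j ∧ j ≤ k ∧ HasColoredPath D c j u v := by
  obtain ⟨hne, S, hS, hw⟩ := h
  obtain ⟨n, f, h0, hn, hf, hinj⟩ := exists_injOn_walk hw
  have hpos : 0 < n := by
    rcases Nat.eq_zero_or_pos n with rfl | h
    · exact absurd (h0.symm.trans hn) hne
    · exact h
  have hstep : ∀ a b : Fin (n + 1), (dirPath n).Adj a b →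
      D.Adj (f a) (f b) ∧ c (f a) (f b) ∈ S := fun a b hab => by
    have hab : (a : ℕ) + 1 = b := hab
    rw [← hab]
    exact hf a (by omega)
  refine ⟨(colorsOn (dirPath n) c fun i => f i).ncard, ?_, ?_, n, fun i => f i,
    ⟨?_, fun a b hab => (hstep a b hab).1⟩, h0, hn, rfl⟩
  · rw [Nat.one_le_iff_ne_zero, Ne, Set.ncard_eq_zero (Set.toFinite _)]
    exact Set.Nonempty.ne_empty
      ⟨_, ⟨0, by omega⟩, ⟨1, by omega⟩, show 0 + 1 = 1 from rfl, rfl⟩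
  · refine le_trans ?_ hS
    rw [← Set.ncard_coe_finset]
    refine Set.ncard_le_ncard ?_ (Set.toFinite _)
    rintro _ ⟨a, b, hab, rfl⟩
    exact (hstep a b hab).2
  · intro a b hab
    by_contra hne'
    rcases lt_or_gt_of_ne hne' with h | h
    · exact hinj a b h (by omega) hab
    · exact hinj b a h (by omega) hab.symm

theorem reach_of_hasColoredPath {u v : V} {j : ℕ} (h1 : 1 ≤ j) (hj : j ≤ k)
    (h : HasColoredPath D c j u v) : Reach D c k u v := by
  classical
  obtain ⟨n, φ, ⟨hinj, hadj⟩, rfl, rfl, hcard⟩ := h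
  refine ⟨fun heq => ?_, (Set.toFinite (colorsOn (dirPath n) c φ)).toFinset, ?_, ?_⟩
  -- Equal ends force the path without arcs, which has no color, against `1 ≤ j`.
  · have h0 : n = 0 := by simpa using (congrArg Fin.val (hinj heq)).symm
    subst h0
    have hempty : colorsOn (dirPath 0) c φ = ∅ := by
      refine Set.eq_empty_of_forall_notMem ?_
      rintro _ ⟨a, b, hab, -⟩
      have hab : (a : ℕ) + 1 = b := hab
      omega
    rw [hempty, Set.ncard_empty] at hcard
    omega
  · rw [← Set.ncard_eq_toFinset_card, hcard]
    exact hj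
  · suffices H : ∀ i (hi : i < n + 1), ReflTransGen (fun x y => D.Adj x y ∧
        c x y ∈ (Set.toFinite (colorsOn (dirPath n) c φ)).toFinset) (φ 0) (φ ⟨i, hi⟩) from
      H n (Nat.lt_succ_self n)
    intro i
    induction i with
    | zero => exact fun _ => .refl
    | succ i ih =>
      intro hi
      have hab : (dirPath n).Adj ⟨i, by omega⟩ ⟨i + 1, hi⟩ := show i + 1 = i + 1 from rfl
      refine (ih (by omega)).tail ⟨hadj _ _ hab, ?_⟩
      rw [Set.Finite.mem_toFinset]
      exact ⟨_, _, hab, rfl⟩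

theorem reach_of_two_arcs (hk : 2 ≤ k) {x y z : V} (hne : x ≠ z) (h₁ : D.Adj x y)
    (h₂ : D.Adj y z) : Reach D c k x z :=
  ⟨hne, {c x y, c y z}, Finset.card_le_two.trans hk,
    .tail (.tail .refl ⟨h₁, by simp⟩) ⟨h₂, by simp⟩⟩

theorem reach_of_arc (hk : 1 ≤ k) {x y : V} (hne : x ≠ y) (h : D.Adj x y) : Reach D c k x y :=
  ⟨hne, {c x y}, (Finset.card_singleton _).trans_le hk, .tail .refl ⟨h, by simp⟩⟩

theorem reach_of_three_arcs {w x y z : V} (hne : w ≠ z) (h₁ : D.Adj w x) (h₂ : D.Adj x y)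
    (h₃ : D.Adj y z) (hk : ({c w x, c x y, c y z} : Finset (Fin m)).card ≤ k) :
    Reach D c k w z :=
  ⟨hne, _, hk, .tail (.tail (.tail .refl ⟨h₁, by simp⟩) ⟨h₂, by simp⟩) ⟨h₃, by simp⟩⟩

theorem reach_of_four_arcs {v w x y z : V} (hne : v ≠ z) (h₁ : D.Adj v w) (h₂ : D.Adj w x)
    (h₃ : D.Adj x y) (h₄ : D.Adj y z)
    (hk : ({c v w, c w x, c x y, c y z} : Finset (Fin m)).card ≤ k) : Reach D c k v z :=
  ⟨hne, _, hk, .tail (.tail (.tail (.tail .refl ⟨h₁, by simp⟩) ⟨h₂, by simp⟩)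
    ⟨h₃, by simp⟩) ⟨h₄, by simp⟩⟩

theorem Reach.reflTransGen {u v : V} (h : Reach D c k u v) : ReflTransGen D.Adj u v := by
  obtain ⟨-, S, -, hw⟩ := h
  exact hw.lift id fun _ _ h => h.1

/-- A colored digraph has a `k`-colored kernel as soon as the asymmetric part of the relation
`Reach` has no cycle. -/
theorem hasColoredKernel_of_acyclic [Finite V] [Nonempty V]
    (h : ∀ v, ¬ TransGen (fun u v => Reach D c k u v ∧ ¬ Reach D c k v u) v v) :
    HasColoredKernel D c k := by
  obtain ⟨K, h₁, h₂⟩ := exists_kernel_of_acyclic (Reach D c k) (fun _ h => h.1 rfl) h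
  have hne : K.Nonempty := by
    by_contra h
    rw [Set.not_nonempty_iff_eq_empty] at h
    obtain ⟨v, hv, -⟩ := h₁ (Classical.arbitrary V) (by simp [h])
    simp [h] at hv
  refine ⟨K, ⟨hne, fun u hu => ?_⟩, hne, fun u hu v hv => ?_⟩
  · obtain ⟨v, hv, huv⟩ := h₁ u hu
    exact ⟨v, hv, huv.hasColoredPath⟩
  · rintro ⟨j, hj, hjk, hp⟩
    exact h₂ u hu v hv (reach_of_hasColoredPath hj hjk hp)

end Reach

/-! ### Semicomplete multipartite relations -/

section Multipartite

variable {V P : Type*} {E Q : V → V → Prop} {part : V → P}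

/-- If `v` can be reached from `u` in the same partite set and `u` cannot be reached back within
the relation `Q`, then there is a path of length two from `u` to `v`. -/
theorem exists_two_arcs (hp : ∀ u v, (E u v ∨ E v u) ↔ part u ≠ part v)
    (two : ∀ x y z, x ≠ z → E x y → E y z → Q x z)
    (h3 : ∀ u v a b, u ≠ v → part u = part v → E u a → E v a → E a b → E b u → E b v → Q v u)
    (h4 : ∀ u v z a b, u ≠ v → u ≠ z → v ≠ z → a ≠ b → part u = part v → part u = part z →
      E u a → E v a → E a z → E z b → E b u → E b v → Q v u)
    {u v : V} (huv : part u = part v) (hne : u ≠ v) (hw : ReflTransGen E u v)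
    (hq : ¬ Q v u) : ∃ y, E u y ∧ E y v := by
  by_contra! hno
  -- Outside the part of `u` and `v`, a vertex is "low" (dominated by both) or "high" (dominating
  -- both): anything else gives a two-arc walk between them.
  have low_or_high : ∀ x, part u ≠ part x →
      (E u x ∧ E v x ∧ ¬ E x u ∧ ¬ E x v) ∨ (E x u ∧ E x v ∧ ¬ E u x ∧ ¬ E v x) := by
    intro x hx
    have h₁ := (hp u x).2 hx
    have h₂ := (hp v x).2 (huv ▸ hx)
    have h₃ := hno x
    have h₄ : E v x → ¬ E x u := fun h h' => hq (two _ _ _ hne.symm h h')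
    tauto
  -- The walk never leaves the low vertices and the common part: `h3` forbids low → high, `h4`
  -- forbids low → part → high. And no low vertex has an arc to `v`.
  have inv : ∀ x, ReflTransGen E u x → (part u ≠ part x ∧ E u x ∧ E v x) ∨
      (part u = part x ∧ x ≠ v ∧
        (x = u ∨ ∃ a, part u ≠ part a ∧ E u a ∧ E v a ∧ E a x)) := by
    intro x hx
    induction hx with
    | refl => exact .inr ⟨rfl, hne, .inl rfl⟩
    | @tail x y _ hxy ih =>
      rcases ih with ⟨hpx, hux, hvx⟩ | ⟨hpx, hxv, rfl | ⟨a, hpa, hua, hva, hax⟩⟩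
      · by_cases hpy : part u = part y
        · refine .inr ⟨hpy, ?_, .inr ⟨x, hpx, hux, hvx, hxy⟩⟩
          rintro rfl
          exact hno x hux hxy
        · refine .inl ⟨hpy, ?_⟩
          rcases low_or_high y hpy with h | h
          · exact ⟨h.1, h.2.1⟩
          · exact absurd (h3 u v x y hne huv hux hvx hxy h.1 h.2.1) hq
      · have hpy := (hp x y).1 (.inl hxy)
        rcases low_or_high y hpy with h | h
        · exact .inl ⟨hpy, h.1, h.2.1⟩
        · exact absurd hxy h.2.2.1
      · have hpy : part u ≠ part y := hpx ▸ (hp x y).1 (.inl hxy)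
        rcases low_or_high y hpy with h | h
        · exact .inl ⟨hpy, h.1, h.2.1⟩
        · rcases low_or_high a hpa with h' | h'
          · refine absurd (h4 u v x a y hne ?_ hxv.symm ?_ huv hpx hua hva hax hxy h.1 h.2.1) hq
            · rintro rfl
              exact h'.2.2.1 hax
            · rintro rfl
              exact h.2.2.1 hua
          · exact absurd hua h'.2.2.1
  rcases inv v hw with h | h
  · exact h.1 huv
  · exact h.2.1 rfl

/-- `b` is an out-neighbor of `a`, or it lies in the partite set of `a` and is joined to `a` by a
path of length two. -/
def Close (E : V → V → Prop) (part : V → P) (a b : V) : Prop :=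
  (part a ≠ part b ∧ E a b) ∨ (part a = part b ∧ ∃ y, E a y ∧ E y b)

theorem close_of_asymm (hp : ∀ u v, (E u v ∨ E v u) ↔ part u ≠ part v)
    (one : ∀ x y, x ≠ y → E x y → Q x y)
    (hs : ∀ u v, u ≠ v → part u = part v → Q u v → ¬ Q v u → ∃ y, E u y ∧ E y v)
    {u v : V} (h : Q u v ∧ ¬ Q v u) : Close E part u v := by
  have hne : u ≠ v := by
    rintro rfl
    exact h.2 h.1
  by_cases huv : part u = part v
  · exact .inr ⟨huv, hs u v hne huv h.1 h.2⟩
  · exact .inl ⟨huv, ((hp u v).2 huv).resolve_right fun h' => h.2 (one _ _ hne.symm h')⟩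

/-- An in-neighbor of the tail of an asymmetric pair that is adjacent to the head is an
in-neighbor of the head. -/
theorem adj_of_adj_of_asymm (hp : ∀ u v, (E u v ∨ E v u) ↔ part u ≠ part v)
    (two : ∀ x y z, x ≠ z → E x y → E y z → Q x z) {x u v : V} (h : Q u v ∧ ¬ Q v u)
    (hxu : E x u) (hxv : part x ≠ part v) : E x v := by
  have hne : u ≠ v := by
    rintro rfl
    exact h.2 h.1
  exact ((hp x v).2 hxv).resolve_right fun h' => h.2 (two _ _ _ hne.symm h' hxu)

theorem not_close_of_asymm
    (one : ∀ x y, x ≠ y → E x y → Q x y)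
    (two : ∀ x y z, x ≠ z → E x y → E y z → Q x z)
    {a b : V} (h : Q b a ∧ ¬ Q a b) : ¬ Close E part a b := by
  have hne : a ≠ b := by
    rintro rfl
    exact h.2 h.1
  rintro (h' | ⟨-, y, h₁, h₂⟩)
  · exact h.2 (one _ _ hne h'.2)
  · exact h.2 (two _ _ _ hne h₁ h₂)

/-- Apply `key` to a cycle minus its last pair: the resulting arc or two-arc walk reverses that
pair. -/
theorem not_transGen_self_of_close {A : V → V → Prop}
    (one : ∀ x y, x ≠ y → E x y → Q x y)
    (two : ∀ x y z, x ≠ z → E x y → E y z → Q x z)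
    (hA : ∀ a b, A a b → Q a b ∧ ¬ Q b a)
    (key : ∀ a b, TransGen A a b → Close E part a b) (v : V) : ¬ TransGen A v v := by
  intro h
  obtain ⟨b, h₁, h₂⟩ := TransGen.tail'_iff.1 h
  rcases reflTransGen_iff_eq_or_transGen.1 h₁ with rfl | h₁
  · exact (hA _ _ h₂).2 (hA _ _ h₂).1
  · exact not_close_of_asymm one two (hA _ _ h₂) (key _ _ h₁)

/-- If the asymmetric part of `Q` contains no arc of a 4-cycle, then it has no cycle. -/
theorem acyclic_of_fourCycle (hp : ∀ u v, (E u v ∨ E v u) ↔ part u ≠ part v)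
    (one : ∀ x y, x ≠ y → E x y → Q x y)
    (two : ∀ x y z, x ≠ z → E x y → E y z → Q x z)
    (hs : ∀ u v, u ≠ v → part u = part v → Q u v → ¬ Q v u → ∃ y, E u y ∧ E y v)
    (hc : ∀ a y b c, a ≠ b → y ≠ c → part a = part b → E a y → E y b → E b c → E c a → Q c b)
    (v : V) : ¬ TransGen (fun u v => Q u v ∧ ¬ Q v u) v v := by
  refine not_transGen_self_of_close (part := part) one two (fun _ _ h => h) ?_ v
  · intro a b hab
    induction hab with
    | single h => exact close_of_asymm hp one hs h
    | @tail b c _ hbc ih =>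
      have hne : b ≠ c := by
        rintro rfl
        exact hbc.2 hbc.1
      by_cases hac : part a = part c
      · refine .inr ⟨hac, ?_⟩
        rcases ih with ⟨hpab, hab⟩ | ⟨hpab, y, hay, hyb⟩
        · refine ⟨b, hab, ((hp b c).2 (hac ▸ hpab.symm)).resolve_right fun h => ?_⟩
          exact hbc.2 (one _ _ hne.symm h)
        · exact ⟨y, hay, adj_of_adj_of_asymm hp two hbc hyb
            (hac ▸ ((hp a y).1 (.inl hay)).symm)⟩
      · refine .inl ⟨hac, ((hp a c).2 hac).resolve_right fun hca => ?_⟩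
        rcases ih with ⟨hpab, hab⟩ | ⟨hpab, y, hay, hyb⟩
        · exact hbc.2 (two _ _ _ hne.symm hca hab)
        -- Here a → y → b → c → a is a 4-cycle, the only obstruction.
        · have hcb : ¬ E c b := fun h => hbc.2 (one _ _ hne.symm h)
          refine hbc.2 (hc a y b c ?_ ?_ hpab hay hyb ?_ hca)
          · rintro rfl
            exact hcb hca
          · rintro rfl
            exact hcb hyb
          · exact ((hp b c).2 (hpab ▸ hac)).resolve_right hcb

/-- The bipartite case, where the asymmetric part of `Q` may contain arcs of 4-cycles, but not
three consecutive ones. -/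
theorem acyclic_of_bipartite (hp : ∀ u v, (E u v ∨ E v u) ↔ part u ≠ part v)
    (bip : ∀ x y z, part x ≠ part y → part x ≠ part z → part y = part z)
    (one : ∀ x y, x ≠ y → E x y → Q x y)
    (two : ∀ x y z, x ≠ z → E x y → E y z → Q x z)
    (hs : ∀ u v, u ≠ v → part u = part v → Q u v → ¬ Q v u → ∃ y, E u y ∧ E y v)
    (hc : ∀ a y b c, a ≠ b → y ≠ c → E a y → E y b → E b c → E c a →
      Q c b ∨ Q y a ∨ Q b y)
    (h₁ : ∀ a y b c w, a ≠ b → y ≠ c → w ≠ a → w ≠ b → part a = part b → part w = part b →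
      part y = part c → E a y → E y b → E b c → E c a → E y w → E w c → Q c b)
    (h₂ : ∀ a y b c w, a ≠ b → y ≠ c → w ≠ y → w ≠ c → part a = part b → part w = part c →
      part y = part c → E a y → E y b → E b c → E c a → E a w → E w b → Q c b)
    (v : V) : ¬ TransGen (fun u v => Q u v ∧ ¬ Q v u) v v := by
  have hpE : ∀ {x y}, E x y → part x ≠ part y := fun h => (hp _ _).1 (.inl h)
  have ne_of : ∀ {x y}, Q x y ∧ ¬ Q y x → x ≠ y := by
    rintro x _ h rfl
    exact h.2 h.1
  have arc : ∀ {x y}, Q x y ∧ ¬ Q y x → part x ≠ part y → E x y ∧ ¬ E y x := by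
    intro x y h hxy
    have h' : ¬ E y x := fun h' => h.2 (one _ _ (ne_of h).symm h')
    exact ⟨((hp x y).2 hxy).resolve_right h', h'⟩
  -- `f` runs through `n + 1` asymmetric pairs, so `n = 0` is a single pair. Below, a, y, b, c are
  -- `f 0`, `f 1` and the last two terms.
  have key : ∀ (n : ℕ) (f : ℕ → V),
      (∀ i ≤ n, Q (f i) (f (i + 1)) ∧ ¬ Q (f (i + 1)) (f i)) →
      (part (f 0) ≠ part (f (n + 1)) → ¬ E (f (n + 1)) (f 0)) ∧
      (part (f 0) = part (f (n + 1)) → ∃ y, E (f 0) y ∧ E y (f (n + 1))) := by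
    intro n
    induction n using Nat.strong_induction_on with
    | _ n ih =>
      intro f hf
      rcases n with _ | n
      · have h := hf 0 le_rfl
        exact ⟨fun hne => (arc h hne).2, fun heq => hs _ _ (ne_of h) heq h.1 h.2⟩
      obtain ⟨ihab, ihab'⟩ := ih n (by omega) f fun i hi => hf i (by omega)
      have ihyc := (ih n (by omega) (fun i => f (i + 1)) fun i hi => hf (i + 1) (by omega)).1
      have hbc := hf (n + 1) le_rfl
      have hay := hf 0 (by omega)
      simp only [zero_add] at ihyc hay
      by_cases hpab : part (f 0) = part (f (n + 1))
      · obtain ⟨x, hax, hxb⟩ := ihab' hpab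
        refine ⟨fun hpac hca => ?_, fun hpac =>
          ⟨x, hax, adj_of_adj_of_asymm hp two hbc hxb (hpac ▸ (hpE hax).symm)⟩⟩
        obtain ⟨hbc', hcb⟩ := arc hbc (hpab ▸ hpac)
        have hneab : f 0 ≠ f (n + 1) := fun h => hcb (h ▸ hca)
        -- If y were in the part of a, then c → a would force c → y, against induction on the chain
        -- from y to c.
        have hpay : part (f 0) ≠ part (f 1) := fun h =>
          ihyc (h ▸ hpac) (adj_of_adj_of_asymm hp two hay hca (h ▸ hpac.symm))
        have hpyc : part (f 1) = part (f (n + 1 + 1)) := bip _ _ _ hpay hpac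
        obtain ⟨hay', hya⟩ := arc hay hpay
        rcases n with _ | n
        · exact hpay hpab
        have ihyb := (ih n (by omega) (fun i => f (i + 1)) fun i hi => hf (i + 1) (by omega)).1
        simp only [zero_add] at ihyb
        have hpyb : part (f 1) ≠ part (f (n + 1 + 1)) := hpab ▸ hpay.symm
        have hyb : E (f 1) (f (n + 1 + 1)) := ((hp _ _).2 hpyb).resolve_right (ihyb hpyb)
        have hneyc : f 1 ≠ f (n + 1 + 1 + 1) := fun h => hcb (h ▸ hyb)
        rcases hc _ _ _ _ hneab hneyc hay' hyb hbc' hca with h | h | h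
        · exact hbc.2 h
        · exact hay.2 h
        -- Only `Q b y` remains, so y, b are not consecutive in the chain. The successor w = `f 2`
        -- of y gives the second 4-cycle: y → w → c if w lies in the part of b, else a → w → b.
        rcases n with _ | n
        · exact (hf 1 (by omega)).2 h
        have hyw := hf 1 (by omega)
        have ihwc := (ih (n + 1) (by omega) (fun i => f (i + 2))
          fun i hi => hf (i + 2) (by omega)).1
        have ihwb := (ih n (by omega) (fun i => f (i + 2)) fun i hi => hf (i + 2) (by omega)).1
        have ihaw := (ih 1 (by omega) f fun i hi => hf i (by omega)).1
        simp only [zero_add, Nat.reduceAdd] at ihwc ihwb hyw ihaw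
        by_cases hpwb : part (f 2) = part (f (n + 1 + 1 + 1))
        · have hyw' := (arc hyw (hpwb ▸ hpyb)).1
          have hpwc := hpE hbc'
          rw [← hpwb] at hpwc
          have hwc := ((hp _ _).2 hpwc).resolve_right (ihwc hpwc)
          by_cases hwb : f 2 = f (n + 1 + 1 + 1)
          · exact hyw.2 (hwb ▸ h)
          · exact hbc.2 (h₁ _ _ _ _ (f 2) hneab hneyc (fun h => hya (h ▸ hyw')) hwb hpab hpwb
              hpyc hay' hyb hbc' hca hyw' hwc)
        · have hwb := ((hp _ _).2 hpwb).resolve_right (ihwb hpwb)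
          have hpaw : part (f 0) ≠ part (f 2) := hpab ▸ Ne.symm hpwb
          have haw := ((hp _ _).2 hpaw).resolve_right (ihaw hpaw)
          exact hbc.2 (h₂ _ _ _ _ (f 2) hneab hneyc (ne_of hyw).symm (fun h => hcb (h ▸ hwb)) hpab
            (bip _ _ _ hpaw hpac) hpyc hay' hyb hbc' hca haw hwb)
      · have hab := ((hp _ _).2 hpab).resolve_right (ihab hpab)
        refine ⟨fun hpac hca => hbc.2 (two _ _ _ (ne_of hbc).symm hca hab), fun hpac =>
          ⟨_, hab, (arc hbc (hpac ▸ Ne.symm hpab)).1⟩⟩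
  refine not_transGen_self_of_close (part := part) one two (fun _ _ h => h) ?_ v
  intro a b hab
  obtain ⟨d, had, hdb⟩ := TransGen.head'_iff.1 hab
  obtain ⟨n, g, rfl, rfl, hg, -⟩ := exists_injOn_walk hdb
  have := key n (fun i => if i = 0 then a else g (i - 1)) (by
    rintro (_ | i) hi
    · simpa using had
    · simpa using hg i (by omega))
  simp only [if_true, Nat.add_sub_cancel, if_neg (Nat.succ_ne_zero n)] at this
  by_cases h : part a = part (g n)
  · exact .inr ⟨h, this.2 h⟩
  · exact .inl ⟨h, ((hp _ _).2 h).resolve_right (this.1 h)⟩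

end Multipartite

/-! ### Copies of short cycles -/

section Copies

variable {V : Type*} {m k : ℕ} {D : Digraph V} {c : V → V → Fin m}

theorem EveryCopyAtMost.exists_finset {W : Type*} {H : Digraph W}
    (h : EveryCopyAtMost D c H k) {φ : W → V} (hφ : IsCopy H D φ) :
    ∃ S : Finset (Fin m), S.card ≤ k ∧ ∀ a b, H.Adj a b → c (φ a) (φ b) ∈ S := by
  classical
  refine ⟨(Set.toFinite (colorsOn H c φ)).toFinset, ?_, fun a b hab => ?_⟩
  · rw [← Set.ncard_eq_toFinset_card]
    exact h φ hφ
  · rw [Set.Finite.mem_toFinset]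
    exact ⟨a, b, hab, rfl⟩

theorem isCopy_dirCycle_three {x y z : V} (hxy : x ≠ y) (hxz : x ≠ z) (hyz : y ≠ z)
    (h₁ : D.Adj x y) (h₂ : D.Adj y z) (h₃ : D.Adj z x) :
    IsCopy (dirCycle 3) D ![x, y, z] := by
  refine ⟨fun i j h => ?_, fun i j h => ?_⟩
  · fin_cases i <;> fin_cases j <;> simp_all
  · obtain rfl : i + 1 = j := h
    fin_cases i <;> assumption

theorem isCopy_dirCycle_four {w x y z : V} (hwx : w ≠ x) (hwy : w ≠ y) (hwz : w ≠ z)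
    (hxy : x ≠ y) (hxz : x ≠ z) (hyz : y ≠ z)
    (h₁ : D.Adj w x) (h₂ : D.Adj x y) (h₃ : D.Adj y z) (h₄ : D.Adj z w) :
    IsCopy (dirCycle 4) D ![w, x, y, z] := by
  refine ⟨fun i j h => ?_, fun i j h => ?_⟩
  · fin_cases i <;> fin_cases j <;> simp_all
  · obtain rfl : i + 1 = j := h
    fin_cases i <;> assumption

theorem isCopy_twoFourCycles {v w x y z : V} (hvw : v ≠ w) (hvx : v ≠ x) (hvy : v ≠ y)
    (hvz : v ≠ z) (hwx : w ≠ x) (hwy : w ≠ y) (hwz : w ≠ z)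
    (hxy : x ≠ y) (hxz : x ≠ z) (hyz : y ≠ z)
    (h₁ : D.Adj v w) (h₂ : D.Adj w x) (h₃ : D.Adj x y) (h₄ : D.Adj y v)
    (h₅ : D.Adj x z) (h₆ : D.Adj z v) :
    IsCopy twoFourCycles D ![v, w, x, y, z] := by
  refine ⟨fun i j h => ?_, fun i j h => ?_⟩
  · fin_cases i <;> fin_cases j <;> simp_all
  · simp only [twoFourCycles, Set.mem_insert_iff, Set.mem_singleton_iff, Prod.mk.injEq] at h
    rcases h with ⟨rfl, rfl⟩ | ⟨rfl, rfl⟩ | ⟨rfl, rfl⟩ | ⟨rfl, rfl⟩ | ⟨rfl, rfl⟩ | ⟨rfl, rfl⟩ <;>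
      assumption

theorem EveryCopyAtMost.dirCycle_four (h : EveryCopyAtMost D c (dirCycle 4) k)
    {w x y z : V} (hwx : w ≠ x) (hwy : w ≠ y) (hwz : w ≠ z)
    (hxy : x ≠ y) (hxz : x ≠ z) (hyz : y ≠ z)
    (h₁ : D.Adj w x) (h₂ : D.Adj x y) (h₃ : D.Adj y z) (h₄ : D.Adj z w) :
    ({c w x, c x y, c y z, c z w} : Finset (Fin m)).card ≤ k := by
  obtain ⟨S, hS, hc⟩ :=
    h.exists_finset (isCopy_dirCycle_four hwx hwy hwz hxy hxz hyz h₁ h₂ h₃ h₄)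
  refine (Finset.card_le_card ?_).trans hS
  simp only [Finset.insert_subset_iff, Finset.singleton_subset_iff]
  exact ⟨hc 0 1 rfl, hc 1 2 rfl, hc 2 3 rfl, hc 3 0 rfl⟩

theorem EveryCopyAtMost.twoFourCycles (h : EveryCopyAtMost D c twoFourCycles k)
    {v w x y z : V} (hvw : v ≠ w) (hvx : v ≠ x) (hvy : v ≠ y)
    (hvz : v ≠ z) (hwx : w ≠ x) (hwy : w ≠ y) (hwz : w ≠ z)
    (hxy : x ≠ y) (hxz : x ≠ z) (hyz : y ≠ z)
    (h₁ : D.Adj v w) (h₂ : D.Adj w x) (h₃ : D.Adj x y) (h₄ : D.Adj y v)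
    (h₅ : D.Adj x z) (h₆ : D.Adj z v) :
    ({c v w, c w x, c x y, c y v, c x z, c z v} : Finset (Fin m)).card ≤ k := by
  obtain ⟨S, hS, hc⟩ := h.exists_finset
    (isCopy_twoFourCycles hvw hvx hvy hvz hwx hwy hwz hxy hxz hyz h₁ h₂ h₃ h₄ h₅ h₆)
  refine (Finset.card_le_card ?_).trans hS
  simp only [Finset.insert_subset_iff, Finset.singleton_subset_iff]
  exact ⟨hc 0 1 (by simp [ColoredDigraph.twoFourCycles]),
    hc 1 2 (by simp [ColoredDigraph.twoFourCycles]),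
    hc 2 3 (by simp [ColoredDigraph.twoFourCycles]),
    hc 3 0 (by simp [ColoredDigraph.twoFourCycles]),
    hc 2 4 (by simp [ColoredDigraph.twoFourCycles]),
    hc 4 0 (by simp [ColoredDigraph.twoFourCycles])⟩

theorem EveryCopyMonochromatic.dirCycle_three (h : EveryCopyMonochromatic D c (dirCycle 3))
    {x y z : V} (hxy : x ≠ y) (hxz : x ≠ z) (hyz : y ≠ z)
    (h₁ : D.Adj x y) (h₂ : D.Adj y z) (h₃ : D.Adj z x) :
    c x y = c y z ∧ c z x = c y z := by
  obtain ⟨i, hi⟩ := h _ (isCopy_dirCycle_three hxy hxz hyz h₁ h₂ h₃)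
  have e₁ : c x y = i := hi 0 1 rfl
  have e₂ : c y z = i := hi 1 2 rfl
  have e₃ : c z x = i := hi 2 0 rfl
  exact ⟨e₁.trans e₂.symm, e₃.trans e₂.symm⟩

theorem EveryCopyMonochromatic.everyCopyAtMost {W : Type*} {H : Digraph W}
    (h : EveryCopyMonochromatic D c H) : EveryCopyAtMost D c H 1 := by
  intro φ hφ
  obtain ⟨i, hi⟩ := h φ hφ
  refine (Set.ncard_le_ncard (t := {i}) ?_ (Set.toFinite _)).trans (Set.ncard_singleton i).le
  rintro _ ⟨a, b, hab, rfl⟩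
  exact hi a b hab

/-- The walk v → a → z → b → u lies in the union of the 4-cycles through `u` and through `v`, which
share a → z → b. -/
theorem reach_of_twoFourCycles {P : Type*} {part : V → P}
    (hp : ∀ u v, (D.Adj u v ∨ D.Adj v u) ↔ part u ≠ part v)
    (h : EveryCopyAtMost D c twoFourCycles k) (u v z a b : V) (huv : u ≠ v) (huz : u ≠ z)
    (hvz : v ≠ z) (hab : a ≠ b) (_ : part u = part v) (_ : part u = part z)
    (hua : D.Adj u a) (hva : D.Adj v a) (haz : D.Adj a z) (hzb : D.Adj z b) (hbu : D.Adj b u)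
    (hbv : D.Adj b v) : Reach D c k v u := by
  have hne : ∀ {x y}, D.Adj x y → x ≠ y := by
    rintro x _ h rfl
    exact (hp x x).1 (.inl h) rfl
  refine reach_of_four_arcs huv.symm hva haz hzb hbu ((Finset.card_le_card ?_).trans
    (h.twoFourCycles (hne haz) hab (hne hua).symm (hne hva).symm (hne hzb) huz.symm hvz.symm
      (hne hbu) (hne hbv) huv haz hzb hbu hua hbv hva))
  intro i
  simp only [Finset.mem_insert, Finset.mem_singleton]
  tauto

end Copies

/-! ### Colored kernels of semicomplete multipartite digraphs -/

section Kernels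

variable {V P : Type*} [Finite V] [Nonempty V] {m k : ℕ} {D : Digraph V} {c : V → V → Fin m}
  {part : V → P}

theorem hasColoredKernel_of_reach (hp : ∀ u v, (D.Adj u v ∨ D.Adj v u) ↔ part u ≠ part v)
    (hk : 2 ≤ k)
    (h3 : ∀ u v a b, u ≠ v → part u = part v → D.Adj u a → D.Adj v a → D.Adj a b →
      D.Adj b u → D.Adj b v → Reach D c k v u)
    (h4 : ∀ u v z a b, u ≠ v → u ≠ z → v ≠ z → a ≠ b → part u = part v → part u = part z →
      D.Adj u a → D.Adj v a → D.Adj a z → D.Adj z b → D.Adj b u → D.Adj b v →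
      Reach D c k v u)
    (hc : ∀ a y b d, a ≠ b → y ≠ d → part a = part b → D.Adj a y → D.Adj y b → D.Adj b d →
      D.Adj d a → Reach D c k d b) :
    HasColoredKernel D c k :=
  hasColoredKernel_of_acyclic <| acyclic_of_fourCycle hp (fun _ _ => reach_of_arc (by omega))
    (fun _ _ _ => reach_of_two_arcs hk)
    (fun _ _ hne huv hq hq' => exists_two_arcs hp (fun _ _ _ => reach_of_two_arcs hk) h3 h4 huv
      hne hq.reflTransGen hq') hc

/-- Three arcs carry at most three colors, so only the four-arc condition needs a hypothesis. -/
theorem hasColoredKernel_of_three_le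
    (hp : ∀ u v, (D.Adj u v ∨ D.Adj v u) ↔ part u ≠ part v) (hk : 3 ≤ k)
    (h4 : ∀ u v z a b, u ≠ v → u ≠ z → v ≠ z → a ≠ b → part u = part v → part u = part z →
      D.Adj u a → D.Adj v a → D.Adj a z → D.Adj z b → D.Adj b u → D.Adj b v →
      Reach D c k v u) :
    HasColoredKernel D c k := by
  have hne : ∀ {x y}, D.Adj x y → x ≠ y := by
    rintro x _ h rfl
    exact (hp x x).1 (.inl h) rfl
  refine hasColoredKernel_of_reach hp (by omega) ?_ h4 ?_
  · intro u v a b huv _ _ hva hab hbu _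
    exact reach_of_three_arcs huv.symm hva hab hbu (Finset.card_le_three.trans hk)
  · intro a y b d _ _ _ hay hyb hbd hda
    exact reach_of_three_arcs (hne hbd).symm hda hay hyb (Finset.card_le_three.trans hk)

theorem hasColoredKernel_two_of_monochromatic
    (hp : ∀ u v, (D.Adj u v ∨ D.Adj v u) ↔ part u ≠ part v)
    (hC3 : EveryCopyMonochromatic D c (dirCycle 3))
    (hC4 : EveryCopyMonochromatic D c (dirCycle 4)) : HasColoredKernel D c 2 := by
  have hne : ∀ {x y}, D.Adj x y → x ≠ y := by
    rintro x _ h rfl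
    exact (hp x x).1 (.inl h) rfl
  have hC4' := hC4.everyCopyAtMost
  refine hasColoredKernel_of_reach hp le_rfl ?_ ?_ ?_
  · intro u v a b huv _ hua hva hab hbu hbv
    refine reach_of_three_arcs huv.symm hva hab hbu ?_
    rw [(hC3.dirCycle_three (hne hva) (hne hbv).symm (hne hab) hva hab hbv).1,
      (hC3.dirCycle_three (hne hua) (hne hbu).symm (hne hab) hua hab hbu).2]
    simp
  · intro u v z a b huv huz hvz hab _ _ hua hva haz hzb hbu hbv
    refine reach_of_four_arcs huv.symm hva haz hzb hbu ?_
    have h₁ := hC4'.dirCycle_four (hne hva) hvz (hne hbv).symm (hne haz) hab (hne hzb)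
      hva haz hzb hbv
    have h₂ := hC4'.dirCycle_four (hne hua) huz (hne hbu).symm (hne haz) hab (hne hzb)
      hua haz hzb hbu
    rw [Finset.card_le_one] at h₁ h₂
    rw [h₁ (c v a) (by simp) (c z b) (by simp), h₁ (c a z) (by simp) (c z b) (by simp),
      h₂ (c b u) (by simp) (c z b) (by simp)]
    simp
  · intro a y b d hab hyd _ hay hyb hbd hda
    refine reach_of_three_arcs (hne hbd).symm hda hay hyb ?_
    have h₁ := hC4'.dirCycle_four (hne hay) hab (hne hda).symm (hne hyb) hyd (hne hbd)
      hay hyb hbd hda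
    refine (Finset.card_le_card ?_).trans (h₁.trans one_le_two)
    intro i
    simp only [Finset.mem_insert, Finset.mem_singleton]
    tauto

theorem hasColoredKernel_three_of_dirCycle_four
    (hp : ∀ u v, (D.Adj u v ∨ D.Adj v u) ↔ part u ≠ part v)
    (hC4 : EveryCopyAtMost D c (dirCycle 4) 2) : HasColoredKernel D c 3 := by
  have hne : ∀ {x y}, D.Adj x y → x ≠ y := by
    rintro x _ h rfl
    exact (hp x x).1 (.inl h) rfl
  refine hasColoredKernel_of_three_le hp le_rfl ?_
  intro u v z a b huv huz hvz hab _ _ hua hva haz hzb hbu hbv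
  refine reach_of_four_arcs huv.symm hva haz hzb hbu ?_
  have h₁ := hC4.dirCycle_four (hne hva) hvz (hne hbv).symm (hne haz) hab (hne hzb)
    hva haz hzb hbv
  -- The 4-cycle through `v` uses at most two colors, and the arc b → u adds at most one.
  calc _ ≤ (insert (c b u) {c v a, c a z, c z b, c b v} : Finset (Fin m)).card := by
        refine Finset.card_le_card fun i => ?_
        simp only [Finset.mem_insert, Finset.mem_singleton]
        tauto
    _ ≤ 3 := (Finset.card_insert_le _ _).trans (by omega)

theorem hasColoredKernel_two_of_bipartite
    (hp : ∀ u v, (D.Adj u v ∨ D.Adj v u) ↔ part u ≠ part v)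
    (bip : ∀ x y z, part x ≠ part y → part x ≠ part z → part y = part z)
    (hC : EveryCopyAtMost D c twoFourCycles 2) (hC4 : EveryCopyAtMost D c (dirCycle 4) 3) :
    HasColoredKernel D c 2 := by
  have hpE : ∀ {x y}, D.Adj x y → part x ≠ part y := fun h => (hp _ _).1 (.inl h)
  have hne : ∀ {x y}, D.Adj x y → x ≠ y := by
    rintro x _ h rfl
    exact hpE h rfl
  refine hasColoredKernel_of_acyclic <| acyclic_of_bipartite hp bip
    (fun _ _ => reach_of_arc (by omega)) (fun _ _ _ => reach_of_two_arcs le_rfl)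
    (fun _ _ hne huv hq hq' => exists_two_arcs hp (fun _ _ _ => reach_of_two_arcs le_rfl) ?_
      (reach_of_twoFourCycles hp hC) huv hne hq.reflTransGen hq') ?_ ?_ ?_
  · intro u v a b _ _ hua _ hab hbu _
    exact absurd (bip _ _ _ (hpE hua) (hpE hbu).symm) (hpE hab)
  · intro a y b d hab hyd hay hyb hbd hda
    have h := hC4.dirCycle_four (hne hay) hab (hne hda).symm (hne hyb) hyd (hne hbd)
      hay hyb hbd hda
    by_contra! hno
    obtain ⟨n₁, n₂, n₃⟩ := hno
    have two_of : ∀ {i j l : Fin m}, i = j ∨ i = l ∨ j = l →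
        ({i, j, l} : Finset (Fin m)).card ≤ 2 := by
      rintro i j l (rfl | rfl | rfl) <;> simp [Finset.card_le_two]
    have m₁ : ¬ (c d a = c a y ∨ c d a = c y b ∨ c a y = c y b) := fun h =>
      n₁ (reach_of_three_arcs (hne hbd).symm hda hay hyb (two_of h))
    have m₂ : ¬ (c y b = c b d ∨ c y b = c d a ∨ c b d = c d a) := fun h =>
      n₂ (reach_of_three_arcs (hne hay).symm hyb hbd hda (two_of h))
    have m₃ : ¬ (c b d = c d a ∨ c b d = c a y ∨ c d a = c a y) := fun h =>
      n₃ (reach_of_three_arcs (hne hyb).symm hbd hda hay (two_of h))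
    -- The three triples cover all six pairs of arcs, so irreversibility of all three arcs would
    -- make the 4-cycle rainbow.
    have h4 : ({c a y, c y b, c b d, c d a} : Finset (Fin m)).card = 4 :=
      Finset.card_eq_four.2 ⟨_, _, _, _, by tauto, by tauto, by tauto, by tauto, by tauto,
        by tauto, rfl⟩
    omega
  -- The two 4-cycles share d → a → y.
  · intro a y b d w hab hyd hwa hwb _ _ _ hay hyb hbd hda hyw hwd
    refine reach_of_three_arcs (hne hbd).symm hda hay hyb ((Finset.card_le_card ?_).trans
      (hC.twoFourCycles (hne hda) hyd.symm (hne hbd).symm (hne hwd).symm (hne hay) hab hwa.symm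
        (hne hyb) (hne hyw) hwb.symm hda hay hyb hbd hyw hwd))
    intro i
    simp only [Finset.mem_insert, Finset.mem_singleton]
    tauto
  -- The two 4-cycles share b → d → a.
  · intro a y b d w hab hyd hwy hwd _ _ _ hay hyb hbd hda haw hwb
    refine reach_of_three_arcs (hne hbd).symm hda hay hyb ((Finset.card_le_card ?_).trans
      (hC.twoFourCycles (hne hbd) hab.symm (hne hyb).symm (hne hwb).symm (hne hda) hyd.symm
        hwd.symm (hne hay) (hne haw) hwy.symm hbd hda hay hyb haw hwb))
    intro i
    simp only [Finset.mem_insert, Finset.mem_singleton]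
    tauto

end Kernels

end ColoredDigraph

theorem mainTheorem5 {V : Type*} [Finite V] (m r : ℕ) (hr : 2 ≤ r) (D : Digraph V)
    (hD : ColoredDigraph.IsSemicompletePartite D r) (c : V → V → Fin m) :
    -- (i)
    (3 ≤ r →
      ColoredDigraph.EveryCopyMonochromatic D c (ColoredDigraph.dirCycle 3) →
      ColoredDigraph.EveryCopyMonochromatic D c (ColoredDigraph.dirCycle 4) →
      ColoredDigraph.HasColoredKernel D c 2) ∧
    -- (ii)
    (3 ≤ r →
      ColoredDigraph.EveryCopyAtMost D c (ColoredDigraph.dirCycle 4) 2 →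
      (ColoredDigraph.EveryCopyAtMost D c (ColoredDigraph.dirCycle 5) 3 ∨
        ColoredDigraph.EveryCopyAtMost D c ColoredDigraph.twoTriangles 2) →
      ColoredDigraph.HasColoredKernel D c 3) ∧
    -- (iii)
    (∀ k : ℕ, 4 ≤ k → ColoredDigraph.HasColoredKernel D c k) ∧
    -- (iv), two colors
    (r = 2 →
      ColoredDigraph.EveryCopyAtMost D c ColoredDigraph.twoFourCycles 2 →
      ColoredDigraph.EveryCopyAtMost D c (ColoredDigraph.dirCycle 4) 3 →
      ColoredDigraph.HasColoredKernel D c 2) ∧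
    -- (iv), three colors
    (r = 2 →
      ColoredDigraph.EveryCopyAtMost D c ColoredDigraph.twoFourCycles 3 →
      ColoredDigraph.HasColoredKernel D c 3) := by
  obtain ⟨part, hsurj, hp⟩ := hD
  obtain ⟨v, -⟩ := hsurj ⟨0, by omega⟩
  have : Nonempty V := ⟨v⟩
  refine ⟨fun _ => ColoredDigraph.hasColoredKernel_two_of_monochromatic hp,
    fun _ h _ => ColoredDigraph.hasColoredKernel_three_of_dirCycle_four hp h,
    fun k hk => ColoredDigraph.hasColoredKernel_of_three_le hp (by omega) ?_,
    fun h2 => ColoredDigraph.hasColoredKernel_two_of_bipartite hp ?_,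
    fun _ h => ColoredDigraph.hasColoredKernel_of_three_le hp le_rfl
      (ColoredDigraph.reach_of_twoFourCycles hp h)⟩
  · intro u v z a b huv _ _ _ _ _ _ hva haz hzb hbu _
    exact ColoredDigraph.reach_of_four_arcs huv.symm hva haz hzb hbu
      (Finset.card_le_four.trans hk)
  · intro x y z hxy hxz
    omega
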